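/- Let $n\ge 0$. A \emph{cone} is an open set $U\subseteq\mathbb C^n$ such that $t\bar x\in U$ whenever $\bar x\in U$ and $t\in\mathbb R$, $t\ge 1$. An \emph{algebraic function} on $U$ is a complex analytic function $f:U\to\mathbb C$ for which there is a nonzero polynomial $p(\bar x,u)\in\mathbb C[x_1,\dots,x_n,u]$ such that $p(\bar x,f(\bar x))=0$ for all $\bar x\in U$. \textbf{Theorem.} Let $U\subseteq\mathbb C^n$ be a cone and let $f_1,\dots,f_n:U\to\mathbb C$ be algebraic functions, none of which vanishes identically on any connected component of $U$ (if $U$ is connected, this just says that each $f_i$ is not the zero function). Assume that $U\cap(2\pi i\,\mathbb Z^*)^n$ is Zariski dense in $\mathbb C^n$, where $\mathbb Z^*=\mathbb Z\setminus\{0\}$. Then there is a point $\bar a=(a_1,\dots,a_n)\in U$ such that $e^{a_i}=f_i(\bar a)$ for every $i=1,\dots,n$. -/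

import Mathlib

/-- A cone (at infinity): an open subset of `ℂⁿ` stable under multiplication by real numbers
`t ≥ 1`. -/
structure IsConeAtInfinity {n : ℕ} (U : Set (Fin n → ℂ)) : Prop where
  isOpen : IsOpen U
  smul_mem : ∀ x ∈ U, ∀ t : ℝ, 1 ≤ t → t • x ∈ U

/-- `f` is an algebraic function on `U`: it is complex analytic on `U` and there is a nonzero
polynomial `p(x, u) ∈ ℂ[x₁, …, xₙ][u]` with `p(x, f x) = 0` for all `x ∈ U`. -/
structure IsAlgebraicFunctionOn {n : ℕ} (U : Set (Fin n → ℂ)) (f : (Fin n → ℂ) → ℂ) : Prop where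
  analytic : AnalyticOnNhd ℂ f U
  exists_poly : ∃ p : Polynomial (MvPolynomial (Fin n) ℂ), p ≠ 0 ∧
    ∀ x ∈ U, p.eval₂ (MvPolynomial.eval x) (f x) = 0

/-- The set `(2πi ℤ*)ⁿ`, where `ℤ*` is the set of nonzero integers. -/
def twoPiINonzeroIntLattice (n : ℕ) : Set (Fin n → ℂ) :=
  {x | ∀ j, ∃ k : ℤ, k ≠ 0 ∧ x j = 2 * (Real.pi : ℂ) * Complex.I * (k : ℂ)}

/-- `S` is Zariski dense in `ℂⁿ`: its Zariski closure, the set of common zeros of all polynomials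
vanishing on `S`, is all of `ℂⁿ`. -/
def IsZariskiDense {n : ℕ} (S : Set (Fin n → ℂ)) : Prop :=
  MvPolynomial.zeroLocus ℂ (MvPolynomial.vanishingIdeal ℂ S) = Set.univ

/-! If `p` lies in `(2πi ℤ)ⁿ`, then `exp (a i) = exp (a i - p i)`, so it suffices to find a fixed
point of `x ↦ p + log f(x)` near `p`. Each `f i` is a root of a polynomial with nonzero constant
coefficient. By Zariski density some lattice point `x₀ ∈ U` avoids the zeros of the leading forms of
the extreme coefficients. Take `p = m x₀`, with `m` a large integer. On a ball of radius `R = ε m`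
about `p`, inside the cone, `f i` and its inverse are bounded by a power of `m`, that is by `exp M`
with `M = O(log m)`. Borel–Carathéodory then makes `log (f i)` Lipschitz with constant `O(M / R)`.
Since `M² = o(R)`, the map is a contraction of a ball of radius `M + 5` about `p`
(`exists_exp_sub_eq`). The growth bound is `eventually_norm_root_le`. -/

open Set Filter Topology Metric

/-! ### Logarithmic oscillation of zero-free holomorphic functions -/

/-- A holomorphic function on the unit disc with values in an annulus varies little in the
logarithmic sense near the centre. -/
lemma exists_exp_ratio_of_disc {h : ℂ → ℂ} {M : ℝ} (hM : 0 < M)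
    (hd : DifferentiableOn ℂ h (ball 0 1)) (hlow : ∀ z ∈ ball (0 : ℂ) 1, Real.exp (-M) ≤ ‖h z‖)
    (hup : ∀ z ∈ ball (0 : ℂ) 1, ‖h z‖ ≤ Real.exp M) {z : ℂ} (hz : ‖z‖ ≤ 1 / 2) :
    ∃ w, h z = h 0 * Complex.exp w ∧ ‖w‖ ≤ 8 * M * ‖z‖ := by
  have hne : ∀ z ∈ ball (0 : ℂ) 1, h z ≠ 0 := fun z hz h0 => by
    have := hlow z hz
    rw [h0, norm_zero] at this
    exact absurd this (not_le.2 (Real.exp_pos _))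
  have h0m : (0 : ℂ) ∈ ball (0 : ℂ) 1 := mem_ball_self one_pos
  have hzm : z ∈ ball (0 : ℂ) 1 := by rw [mem_ball_zero_iff]; linarith
  have hat : ∀ z ∈ ball (0 : ℂ) 1, DifferentiableAt ℂ h z := fun z hz =>
    hd.differentiableAt (isOpen_ball.mem_nhds hz)
  -- `l` is a primitive of `h' / h` with `l 0 = 0`, hence a branch of `log (h / h 0)`.
  obtain ⟨l, hl0, hl⟩ := (((hd.deriv isOpen_ball).div hd hne).isExactOn_ball).with_val_at 0 0
  have hconst : ∀ z ∈ ball (0 : ℂ) 1, h z * Complex.exp (-l z) = h 0 * Complex.exp (-l 0) := by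
    intro z hz
    have hder : ∀ z ∈ ball (0 : ℂ) 1, HasDerivAt (fun z => h z * Complex.exp (-l z)) 0 z := by
      intro z hz
      convert! (hat z hz).hasDerivAt.mul (hl z hz).neg.cexp using 1
      have := hne z hz
      simp only [Pi.div_apply]
      field_simp
      ring
    exact isOpen_ball.is_const_of_deriv_eq_zero (convex_ball 0 1).isPreconnected
      (fun z hz => (hder z hz).differentiableAt.differentiableWithinAt)
      (fun z hz => (hder z hz).deriv) hz h0m
  have heq : ∀ z ∈ ball (0 : ℂ) 1, h z = h 0 * Complex.exp (l z) := by
    intro z hz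
    have := hconst z hz
    rw [hl0, neg_zero, Complex.exp_zero, mul_one, Complex.exp_neg] at this
    rw [← this, inv_mul_cancel_right₀ (Complex.exp_ne_zero _)]
  refine ⟨l z, heq z hzm, ?_⟩
  have hre : MapsTo l (ball 0 1) {z | z.re ≤ 2 * M} := by
    intro z hz
    have h1 := congrArg norm (heq z hz)
    rw [norm_mul, Complex.norm_exp] at h1
    have h2 : Real.exp (-M) * Real.exp (l z).re ≤ Real.exp M := by
      calc _ ≤ ‖h 0‖ * Real.exp (l z).re := by
            gcongr
            exact hlow 0 h0m
        _ ≤ _ := h1 ▸ hup z hz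
    rw [← Real.exp_add, Real.exp_le_exp] at h2
    change (l z).re ≤ 2 * M
    linarith
  have hbc := Complex.borelCaratheodory_zero (by positivity : 0 < 2 * M)
    (fun z hz => (hl z hz).differentiableAt.differentiableWithinAt) hre one_pos hzm hl0
  refine hbc.trans ?_
  rw [div_le_iff₀ (by linarith)]
  nlinarith [mul_nonneg hM.le (norm_nonneg z)]

/-- A holomorphic function on a ball of a complex normed space with values in an annulus is
Lipschitz in the logarithmic sense. -/
lemma exists_exp_ratio_of_ball {E : Type*} [NormedAddCommGroup E] [NormedSpace ℂ E] {g : E → ℂ}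
    {p : E} {R M : ℝ} (hR : 0 < R) (hM : 0 < M) (hd : DifferentiableOn ℂ g (ball p R))
    (hlow : ∀ z ∈ ball p R, Real.exp (-M) ≤ ‖g z‖) (hup : ∀ z ∈ ball p R, ‖g z‖ ≤ Real.exp M)
    {x y : E} (hx : ‖x - p‖ ≤ R / 2) (hxy : ‖y - x‖ ≤ R / 4) :
    ∃ w, g y = g x * Complex.exp w ∧ ‖w‖ ≤ 16 * M * ‖y - x‖ / R := by
  rcases eq_or_ne y x with rfl | hne
  · exact ⟨0, by simp⟩
  have hpos : 0 < ‖y - x‖ := norm_pos_iff.2 (sub_ne_zero.2 hne)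
  -- The disc `x + z • v` with `‖v‖ = R / 2` stays in the ball and meets `y` at `z = c⁻¹`, of norm
  -- at most `1 / 2`.
  set c : ℝ := R / 2 / ‖y - x‖ with hc
  have hcpos : 0 < c := by positivity
  set v : E := (c : ℂ) • (y - x) with hv
  have hvn : ‖v‖ = R / 2 := by
    rw [hv, norm_smul, Complex.norm_real, Real.norm_of_nonneg hcpos.le, hc]
    field_simp
  have hmap : MapsTo (fun z : ℂ => x + z • v) (ball 0 1) (ball p R) := by
    intro z hz
    rw [mem_ball_zero_iff] at hz
    rw [mem_ball, dist_eq_norm]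
    calc ‖x + z • v - p‖ = ‖(x - p) + z • v‖ := by congr 1; abel
      _ ≤ ‖x - p‖ + ‖z‖ * (R / 2) := by rw [← hvn, ← norm_smul]; exact norm_add_le _ _
      _ < R := by nlinarith
  have hcinv : ‖((c⁻¹ : ℝ) : ℂ)‖ = 2 * ‖y - x‖ / R := by
    rw [Complex.norm_real, Real.norm_of_nonneg (by positivity), hc]
    field_simp
  obtain ⟨w, hw, hwn⟩ := exists_exp_ratio_of_disc (h := fun z : ℂ => g (x + z • v)) hM
    (hd.comp (by fun_prop) hmap) (fun z hz => hlow _ (hmap hz)) (fun z hz => hup _ (hmap hz))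
    (z := ((c⁻¹ : ℝ) : ℂ)) (by rw [hcinv, div_le_iff₀ hR]; linarith)
  refine ⟨w, ?_, ?_⟩
  · have : x + ((c⁻¹ : ℝ) : ℂ) • v = y := by
      rw [hv, smul_smul, ← Complex.ofReal_mul, inv_mul_cancel₀ hcpos.ne', Complex.ofReal_one,
        one_smul]
      abel
    simpa only [this, zero_smul, add_zero] using hw
  · refine hwn.trans (le_of_eq ?_)
    rw [hcinv]
    ring

/-! ### The fixed point argument -/

/-- A contraction argument for the system `exp (a i - p i) = F i a`, when the `F i` are
bounded above and below on a large ball. -/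
lemma exists_exp_sub_eq {n : ℕ} {F : Fin n → (Fin n → ℂ) → ℂ} {p : Fin n → ℂ} {R M : ℝ}
    (hM : 0 < M) (hR : 32 * (M + 5) ^ 2 ≤ R) (hd : ∀ i, DifferentiableOn ℂ (F i) (ball p R))
    (hlow : ∀ i, ∀ z ∈ ball p R, Real.exp (-M) ≤ ‖F i z‖)
    (hup : ∀ i, ∀ z ∈ ball p R, ‖F i z‖ ≤ Real.exp M) :
    ∃ a ∈ ball p R, ∀ i, Complex.exp (a i - p i) = F i a := by
  have hRpos : 0 < R := lt_of_lt_of_le (by positivity) hR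
  -- `M + 4` bounds `log (F i p)`, using `π ≤ 4`; the extra `1` bounds the variation of the
  -- logarithm over the ball.
  set r : ℝ := M + 5 with hr
  have hrR : r ≤ R / 8 := by nlinarith
  have hne : ∀ i, ∀ z ∈ ball p R, F i z ≠ 0 := fun i z hz h0 => by
    have := hlow i z hz
    rw [h0, norm_zero] at this
    exact absurd this (not_le.2 (Real.exp_pos _))
  have hsub : closedBall p r ⊆ ball p R := closedBall_subset_ball (by linarith)
  have hpm : p ∈ closedBall p r := mem_closedBall_self (by linarith)
  have key : ∀ i, ∀ x ∈ closedBall p r, ∀ y ∈ closedBall p r, ∃ w,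
      F i y = F i x * Complex.exp w ∧ ‖w‖ ≤ 1 / 2 * ‖y - x‖ ∧ ‖w‖ ≤ 1 := by
    intro i x hx y hy
    rw [mem_closedBall, dist_eq_norm] at hx hy
    have hxy : ‖y - x‖ ≤ 2 * r := by
      calc ‖y - x‖ = ‖(y - p) - (x - p)‖ := by congr 1; abel
        _ ≤ ‖y - p‖ + ‖x - p‖ := norm_sub_le _ _
        _ ≤ 2 * r := by linarith
    obtain ⟨w, hw, hwn⟩ := exists_exp_ratio_of_ball hRpos hM (hd i) (hlow i) (hup i)
      (x := x) (y := y) (by linarith) (by linarith)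
    refine ⟨w, hw, hwn.trans ?_, hwn.trans ?_⟩
    · rw [div_le_iff₀ hRpos]
      have : 32 * M ≤ R := by nlinarith
      nlinarith [norm_nonneg (y - x)]
    · rw [div_le_iff₀ hRpos]
      nlinarith [norm_nonneg (y - x)]
  have hlogexp : ∀ w : ℂ, ‖w‖ ≤ 1 → Complex.log (Complex.exp w) = w := by
    intro w hw
    have h1 := abs_le.1 ((Complex.abs_im_le_norm w).trans hw)
    exact Complex.log_exp (by linarith [Real.pi_gt_three]) (by linarith [Real.pi_gt_three])
  -- The ratio `F i x / F i p` is `exp w` with `‖w‖ ≤ 1`, so its principal logarithm is `w` and no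
  -- branch cut is met.
  set Φ : (Fin n → ℂ) → (Fin n → ℂ) := fun x i =>
    p i + Complex.log (F i p) + Complex.log (F i x / F i p) with hΦ
  have hlogF : ∀ i, ‖Complex.log (F i p)‖ ≤ M + 4 := by
    intro i
    have hpR := hsub hpm
    have h1 : |(Complex.log (F i p)).re| ≤ M := by
      rw [Complex.log_re, abs_le]
      have hp0 : 0 < ‖F i p‖ := norm_pos_iff.2 (hne i p hpR)
      exact ⟨(Real.le_log_iff_exp_le hp0).2 (hlow i p hpR),
        (Real.log_le_iff_le_exp hp0).2 (hup i p hpR)⟩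
    have h2 : |(Complex.log (F i p)).im| ≤ 4 := by
      rw [Complex.log_im]
      exact (Complex.abs_arg_le_pi _).trans Real.pi_le_four
    exact (Complex.norm_le_abs_re_add_abs_im _).trans (add_le_add h1 h2)
  have hmaps : MapsTo Φ (closedBall p r) (closedBall p r) := by
    intro x hx
    rw [mem_closedBall, dist_pi_le_iff (by linarith)]
    intro i
    obtain ⟨w, hw, -, hw1⟩ := key i p hpm x hx
    rw [dist_eq_norm]
    calc ‖Φ x i - p i‖ = ‖Complex.log (F i p) + w‖ := by
          simp only [hΦ]
          rw [hw, mul_div_cancel_left₀ _ (hne i p (hsub hpm)), hlogexp w hw1]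
          congr 1; ring
      _ ≤ (M + 4) + 1 := (norm_add_le _ _).trans (add_le_add (hlogF i) hw1)
      _ = r := by rw [hr]; ring
  have hlip : ∀ x ∈ closedBall p r, ∀ y ∈ closedBall p r, dist (Φ x) (Φ y) ≤ 1 / 2 * dist x y := by
    intro x hx y hy
    rw [dist_pi_le_iff (by positivity)]
    intro i
    obtain ⟨u, hu, -, hu1⟩ := key i p hpm x hx
    obtain ⟨v, hv, -, hv1⟩ := key i p hpm y hy
    obtain ⟨w, hw, hwn, hw1⟩ := key i y hy x hx
    have hp0 := hne i p (hsub hpm)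
    have hexp : Complex.exp u = Complex.exp (v + w) := by
      rw [Complex.exp_add]
      apply mul_left_cancel₀ hp0
      rw [← hu, hw, hv]
      ring
    -- The two sides differ by a multiple of `2πi` of norm at most `3 < 2π`.
    have huvw : u - v = w := by
      obtain ⟨k, hk⟩ := Complex.exp_eq_exp_iff_exists_int.1 hexp
      have h3 : ‖(k : ℂ) * (2 * Real.pi * Complex.I)‖ ≤ 3 := by
        have : (k : ℂ) * (2 * Real.pi * Complex.I) = u - v - w := by rw [hk]; ring
        rw [this]
        exact ((norm_sub_le _ _).trans (add_le_add (norm_sub_le _ _) le_rfl)).trans (by linarith)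
      have hk0 : k = 0 := by
        by_contra hk0
        have h1 : (1 : ℝ) ≤ |(k : ℝ)| := by exact_mod_cast Int.one_le_abs hk0
        simp only [norm_mul, Complex.norm_intCast, Complex.norm_I, Complex.norm_real,
          Complex.norm_ofNat, Real.norm_of_nonneg Real.pi_pos.le, mul_one] at h3
        nlinarith [Real.pi_gt_three]
      rw [hk, hk0]
      push_cast
      ring
    rw [dist_eq_norm, dist_eq_norm]
    refine le_trans (le_of_eq ?_) hwn
    simp only [hΦ]
    rw [hu, hv, mul_div_cancel_left₀ _ hp0, mul_div_cancel_left₀ _ hp0, hlogexp u hu1,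
      hlogexp v hv1, ← huvw]
    congr 1; ring
  have hcontr : ContractingWith (1 / 2) (hmaps.restrict Φ _ _) := by
    refine ⟨by norm_num, LipschitzWith.of_dist_le_mul fun x y => ?_⟩
    simpa [Subtype.dist_eq] using hlip x x.2 y y.2
  obtain ⟨a, ha, hfix, -⟩ := ContractingWith.exists_fixedPoint' isClosed_closedBall.isComplete
    hmaps hcontr hpm (edist_ne_top _ _)
  refine ⟨a, hsub ha, fun i => ?_⟩
  have hai : a i = p i + Complex.log (F i p) + Complex.log (F i a / F i p) :=
    (congrFun hfix i).symm
  have hp0 := hne i p (hsub hpm)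
  have ha0 := hne i a (hsub ha)
  have : a i - p i = Complex.log (F i p) + Complex.log (F i a / F i p) := by
    linear_combination hai
  rw [this, Complex.exp_add, Complex.exp_log hp0, Complex.exp_log (div_ne_zero ha0 hp0),
    mul_div_cancel₀ _ hp0]

/-! ### Growth of polynomials along rays -/

lemma MvPolynomial.IsHomogeneous.eval_smul {σ R : Type*} [CommSemiring R] {φ : MvPolynomial σ R}
    {d : ℕ} (hφ : φ.IsHomogeneous d) (t : R) (x : σ → R) :
    eval (t • x) φ = t ^ d * eval x φ := by
  classical
  rw [eval_eq, eval_eq, Finset.mul_sum]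
  refine Finset.sum_congr rfl fun m hm => ?_
  have hdeg : m.sum (fun _ e => e) = d := by
    have := hφ (mem_support_iff.1 hm)
    rwa [Finsupp.weight_apply, Finsupp.sum_congr (g2 := fun _ e => e) (by simp)] at this
  simp only [Pi.smul_apply, smul_eq_mul, mul_pow, Finset.prod_mul_distrib, Finset.prod_pow_eq_pow_sum]
  rw [← hdeg, Finsupp.sum]
  ring

/-- The rescaled value is a polynomial in `(1/t, x)`; at `1/t = 0` only the leading form survives.
The product filter makes later bounds uniform for directions near `x₀`. -/
lemma tendsto_eval_smul_div_pow {n : ℕ} (a : MvPolynomial (Fin n) ℂ) (x₀ : Fin n → ℂ) :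
    Tendsto (fun q : ℝ × (Fin n → ℂ) =>
      ((q.1 : ℂ) ^ a.totalDegree)⁻¹ * MvPolynomial.eval (q.1 • q.2) a) (atTop ×ˢ 𝓝 x₀)
      (𝓝 (MvPolynomial.eval x₀ (MvPolynomial.homogeneousComponent a.totalDegree a))) := by
  set D := a.totalDegree with hD
  set G : ℂ × (Fin n → ℂ) → ℂ := fun s => ∑ k ∈ Finset.range (D + 1),
    s.1 ^ (D - k) * MvPolynomial.eval s.2 (MvPolynomial.homogeneousComponent k a) with hG
  have hcont : Continuous G := by
    refine continuous_finsetSum _ fun k _ => (continuous_fst.pow _).mul ?_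
    exact (MvPolynomial.continuous_eval _).comp continuous_snd
  have hval : G (0, x₀) = MvPolynomial.eval x₀ (MvPolynomial.homogeneousComponent D a) := by
    simp only [hG]
    rw [Finset.sum_eq_single D]
    · simp
    · intro k hk hkD
      have : k < D := lt_of_le_of_ne (Nat.lt_succ_iff.1 (Finset.mem_range.1 hk)) hkD
      rw [zero_pow (Nat.sub_ne_zero_of_lt this), zero_mul]
    · simp
  have hlim : Tendsto (fun q : ℝ × (Fin n → ℂ) => (((q.1⁻¹ : ℝ) : ℂ), q.2)) (atTop ×ˢ 𝓝 x₀)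
      (𝓝 (0, x₀)) := by
    rw [nhds_prod_eq]
    refine Tendsto.prodMk ?_ tendsto_snd
    have : Tendsto (fun t : ℝ => ((t⁻¹ : ℝ) : ℂ)) atTop (𝓝 ((0 : ℝ) : ℂ)) :=
      (Complex.continuous_ofReal.tendsto 0).comp tendsto_inv_atTop_zero
    rw [Complex.ofReal_zero] at this
    exact this.comp tendsto_fst
  rw [← hval]
  refine ((hcont.tendsto _).comp hlim).congr' ?_
  filter_upwards [tendsto_fst.eventually (eventually_gt_atTop (0 : ℝ))] with q hq
  have hq0 : (q.1 : ℂ) ≠ 0 := Complex.ofReal_ne_zero.2 hq.ne'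
  have hsm : q.1 • q.2 = (q.1 : ℂ) • q.2 := by ext; simp
  conv_rhs => rw [← MvPolynomial.sum_homogeneousComponent a, map_sum, Finset.mul_sum]
  simp only [Function.comp_apply, hG]
  refine Finset.sum_congr rfl fun k hk => ?_
  have hk' : k ≤ D := Nat.lt_succ_iff.1 (Finset.mem_range.1 hk)
  rw [hsm, (MvPolynomial.homogeneousComponent_isHomogeneous k a).eval_smul, ← mul_assoc]
  congr 1
  rw [Complex.ofReal_inv, inv_pow, eq_comm, inv_mul_eq_iff_eq_mul₀ (pow_ne_zero _ hq0),
    ← Nat.sub_add_cancel hk', pow_add]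
  field_simp
  simp

lemma eventually_norm_eval_smul_le {n : ℕ} (a : MvPolynomial (Fin n) ℂ) (x₀ : Fin n → ℂ) :
    ∃ N : ℕ, ∀ᶠ q : ℝ × (Fin n → ℂ) in atTop ×ˢ 𝓝 x₀,
      ‖MvPolynomial.eval (q.1 • q.2) a‖ ≤ q.1 ^ N := by
  refine ⟨a.totalDegree + 1, ?_⟩
  have h := (tendsto_eval_smul_div_pow a x₀).norm
  set B := ‖MvPolynomial.eval x₀ (MvPolynomial.homogeneousComponent a.totalDegree a)‖
  filter_upwards [h.eventually (eventually_le_nhds (lt_add_one B)),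
    tendsto_fst.eventually (eventually_ge_atTop (B + 1)),
    tendsto_fst.eventually (eventually_gt_atTop (0 : ℝ))] with q h1 h2 h3
  rw [norm_mul, norm_inv, norm_pow, Complex.norm_real, Real.norm_of_nonneg h3.le,
    inv_mul_le_iff₀ (by positivity)] at h1
  refine h1.trans ?_
  rw [pow_succ]
  gcongr

lemma eventually_one_le_mul_norm_eval_smul {n : ℕ} {a : MvPolynomial (Fin n) ℂ} {x₀ : Fin n → ℂ}
    (hx₀ : MvPolynomial.eval x₀ (MvPolynomial.homogeneousComponent a.totalDegree a) ≠ 0) :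
    ∀ᶠ q : ℝ × (Fin n → ℂ) in atTop ×ˢ 𝓝 x₀, 1 ≤ q.1 * ‖MvPolynomial.eval (q.1 • q.2) a‖ := by
  have h := (tendsto_eval_smul_div_pow a x₀).norm
  set B := ‖MvPolynomial.eval x₀ (MvPolynomial.homogeneousComponent a.totalDegree a)‖
  have hB : 0 < B := norm_pos_iff.2 hx₀
  filter_upwards [h.eventually (eventually_ge_nhds (half_lt_self hB)),
    tendsto_fst.eventually (eventually_ge_atTop (2 / B)),
    tendsto_fst.eventually (eventually_ge_atTop (1 : ℝ))] with q h1 h2 h3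
  have h0 : 0 < q.1 := by linarith
  rw [norm_mul, norm_inv, norm_pow, Complex.norm_real, Real.norm_of_nonneg h0.le,
    le_inv_mul_iff₀ (by positivity)] at h1
  have h4 : B / 2 ≤ ‖MvPolynomial.eval (q.1 • q.2) a‖ :=
    (le_mul_of_one_le_left (by positivity) (one_le_pow₀ h3)).trans h1
  calc 1 = 2 / B * (B / 2) := by field_simp
    _ ≤ _ := by gcongr

/-! ### Bounds for roots -/

/-- Cauchy's root bound: when `‖u‖ > 1`, the lower terms total at most `d * A * ‖u‖ ^ (d - 1)` and
must balance the leading one. -/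
lemma norm_root_le_max {c : ℕ → ℂ} {d : ℕ} {A B : ℝ} {u : ℂ} (hB : 0 ≤ B)
    (hc : ∀ j < d, ‖c j‖ ≤ A) (hd : 1 ≤ B * ‖c d‖)
    (hu : ∑ j ∈ Finset.range (d + 1), c j * u ^ j = 0) : ‖u‖ ≤ max 1 (d * A * B) := by
  rcases le_or_gt ‖u‖ 1 with h1 | h1
  · exact le_max_of_le_left h1
  refine le_max_of_le_right ?_
  rw [Finset.sum_range_succ] at hu
  obtain _ | e := d
  · have : c 0 = 0 := by simpa using hu
    rw [this, norm_zero, mul_zero] at hd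
    linarith
  have hA : 0 ≤ A := (norm_nonneg _).trans (hc 0 (Nat.succ_pos e))
  have h2 : ‖c (e + 1)‖ * ‖u‖ ^ (e + 1) ≤ (e + 1 : ℕ) * (A * ‖u‖ ^ e) := by
    rw [← norm_pow, ← norm_mul, eq_neg_of_add_eq_zero_right hu, norm_neg]
    refine (norm_sum_le _ _).trans ?_
    rw [← nsmul_eq_mul]
    nth_rewrite 2 [← Finset.card_range (e + 1)]
    refine Finset.sum_le_card_nsmul _ _ _ fun j hj => ?_
    have hj' := Finset.mem_range.1 hj
    rw [norm_mul, norm_pow]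
    exact mul_le_mul (hc j hj') (pow_le_pow_right₀ h1.le (Nat.lt_succ_iff.1 hj')) (by positivity) hA
  have h3 : ‖u‖ * ‖u‖ ^ e ≤ ((e + 1 : ℕ) * A * B) * ‖u‖ ^ e := by
    calc ‖u‖ * ‖u‖ ^ e = 1 * ‖u‖ ^ (e + 1) := by ring
      _ ≤ B * ‖c (e + 1)‖ * ‖u‖ ^ (e + 1) := by gcongr
      _ = B * (‖c (e + 1)‖ * ‖u‖ ^ (e + 1)) := by ring
      _ ≤ B * ((e + 1 : ℕ) * (A * ‖u‖ ^ e)) := by gcongr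
      _ = _ := by ring
  exact le_of_mul_le_mul_right h3 (by positivity)

/-- `u⁻¹` is a root of the reversed polynomial, whose leading coefficient is `c 0`. -/
lemma norm_inv_root_le_max {c : ℕ → ℂ} {d : ℕ} {A B : ℝ} {u : ℂ} (hB : 0 ≤ B)
    (hc : ∀ j ≤ d, ‖c j‖ ≤ A) (hd : 1 ≤ B * ‖c 0‖)
    (hu : ∑ j ∈ Finset.range (d + 1), c j * u ^ j = 0) :
    u ≠ 0 ∧ ‖u⁻¹‖ ≤ max 1 (d * A * B) := by
  have hu0 : u ≠ 0 := by
    rintro rfl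
    rw [Finset.sum_range_succ'] at hu
    have : c 0 = 0 := by simpa using hu
    rw [this, norm_zero, mul_zero] at hd
    linarith
  refine ⟨hu0, norm_root_le_max (c := fun j => c (d - j)) hB (fun j _ => hc _ (Nat.sub_le d j))
    (by simpa using hd) ?_⟩
  rw [← Finset.sum_range_reflect]
  have : ∑ j ∈ Finset.range (d + 1), c (d - (d + 1 - 1 - j)) * u⁻¹ ^ (d + 1 - 1 - j)
      = (u ^ d)⁻¹ * ∑ j ∈ Finset.range (d + 1), c j * u ^ j := by
    rw [Finset.mul_sum]
    refine Finset.sum_congr rfl fun j hj => ?_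
    have hj' : j ≤ d := Nat.lt_succ_iff.1 (Finset.mem_range.1 hj)
    rw [Nat.add_sub_cancel, Nat.sub_sub_self hj']
    obtain ⟨e, rfl⟩ := Nat.exists_eq_add_of_le hj'
    rw [Nat.add_sub_cancel_left, pow_add, inv_pow]
    field_simp
  rw [this, hu, mul_zero]

/-- Roots of a polynomial over `ℂ[x₁, …, xₙ]` have polynomial growth, and so have their inverses,
along rays close to one on which the leading forms of the extreme coefficients do not vanish. -/
lemma eventually_norm_root_le {n : ℕ} {P : Polynomial (MvPolynomial (Fin n) ℂ)} {x₀ : Fin n → ℂ}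
    (hlead : MvPolynomial.eval x₀
      (MvPolynomial.homogeneousComponent P.leadingCoeff.totalDegree P.leadingCoeff) ≠ 0)
    (hzero : MvPolynomial.eval x₀
      (MvPolynomial.homogeneousComponent (P.coeff 0).totalDegree (P.coeff 0)) ≠ 0) :
    ∃ N : ℕ, ∀ᶠ q : ℝ × (Fin n → ℂ) in atTop ×ˢ 𝓝 x₀, ∀ u : ℂ,
      P.eval₂ (MvPolynomial.eval (q.1 • q.2)) u = 0 → u ≠ 0 ∧ ‖u‖ ≤ q.1 ^ N ∧ ‖u⁻¹‖ ≤ q.1 ^ N := by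
  set d := P.natDegree with hd
  choose K hK using fun j => eventually_norm_eval_smul_le (P.coeff j) x₀
  set S := ∑ j ∈ Finset.range (d + 1), K j with hS
  refine ⟨S + 2, ?_⟩
  filter_upwards [(Finset.eventually_all (Finset.range (d + 1))).2 fun j _ => hK j,
    eventually_one_le_mul_norm_eval_smul hlead, eventually_one_le_mul_norm_eval_smul hzero,
    tendsto_fst.eventually (eventually_ge_atTop (1 : ℝ)),
    tendsto_fst.eventually (eventually_ge_atTop (d : ℝ))] with q h1 h2 h3 h4 h5 u hu
  have hq0 : 0 ≤ q.1 := by linarith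
  rw [Polynomial.eval₂_eq_sum_range] at hu
  have hbd : ∀ j ≤ d, ‖MvPolynomial.eval (q.1 • q.2) (P.coeff j)‖ ≤ q.1 ^ S := fun j hj =>
    (h1 j (Finset.mem_range.2 (Nat.lt_succ_of_le hj))).trans (pow_le_pow_right₀ h4
      (Finset.single_le_sum (f := K) (fun _ _ => Nat.zero_le _)
        (Finset.mem_range.2 (Nat.lt_succ_of_le hj))))
  have hmax : max 1 (d * q.1 ^ S * q.1) ≤ q.1 ^ (S + 2) := by
    refine max_le (one_le_pow₀ h4) ?_
    calc d * q.1 ^ S * q.1 ≤ q.1 * q.1 ^ S * q.1 := by gcongr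
      _ = _ := by ring
  obtain ⟨hu0, hui⟩ := norm_inv_root_le_max hq0 hbd h3 hu
  exact ⟨hu0, (norm_root_le_max hq0 (fun j hj => hbd j hj.le) h2 hu).trans hmax, hui.trans hmax⟩

/-- An algebraic function that vanishes on no component is a root of a polynomial with nonzero
constant coefficient. -/
lemma IsAlgebraicFunctionOn.exists_poly_coeff_zero_ne {n : ℕ} {U : Set (Fin n → ℂ)}
    {f : (Fin n → ℂ) → ℂ} (hU : IsOpen U) (hf : IsAlgebraicFunctionOn U f)
    (hf0 : ∀ x ∈ U, ∃ y ∈ connectedComponentIn U x, f y ≠ 0) :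
    ∃ P : Polynomial (MvPolynomial (Fin n) ℂ), P.coeff 0 ≠ 0 ∧
      ∀ x ∈ U, P.eval₂ (MvPolynomial.eval x) (f x) = 0 := by
  obtain ⟨p, hp0, hp⟩ := hf.exists_poly
  -- `P` is `p` with every factor `X` removed. Where `P(x, f x) ≠ 0`, the removed power forces `f =
  -- 0` nearby, hence on the whole component.
  obtain ⟨P, hP, hdvd⟩ := Polynomial.exists_eq_pow_rootMultiplicity_mul_and_not_dvd p hp0 0
  rw [Polynomial.C_0, sub_zero] at hP hdvd
  refine ⟨P, fun h => hdvd (Polynomial.X_dvd_iff.2 h), fun x hx => ?_⟩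
  by_contra hne
  have hcont : ContinuousAt (fun y => P.eval₂ (MvPolynomial.eval y) (f y)) x := by
    simp only [Polynomial.eval₂_eq_sum_range]
    refine tendsto_finsetSum _ fun j _ => ?_
    exact ((MvPolynomial.continuous_eval (P.coeff j)).continuousAt).mul
      ((hf.analytic x hx).continuousAt.pow j)
  have hev : f =ᶠ[𝓝 x] 0 := by
    filter_upwards [hcont.eventually_ne hne, hU.mem_nhds hx] with y hy hyU
    have h1 := hp y hyU
    rw [hP, Polynomial.eval₂_mul, Polynomial.eval₂_pow, Polynomial.eval₂_X] at h1
    exact eq_zero_of_pow_eq_zero ((mul_eq_zero.1 h1).resolve_right hy)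
  obtain ⟨y, hy, hfy⟩ := hf0 x hx
  exact hfy ((hf.analytic.mono (connectedComponentIn_subset U x)
    ).eqOn_zero_of_preconnected_of_eventuallyEq_zero isPreconnected_connectedComponentIn
      (mem_connectedComponentIn hx) hev hy)

lemma IsZariskiDense.exists_eval_ne_zero {n : ℕ} {S : Set (Fin n → ℂ)} (hS : IsZariskiDense S)
    {P : MvPolynomial (Fin n) ℂ} (hP : P ≠ 0) : ∃ x ∈ S, MvPolynomial.eval x P ≠ 0 := by
  by_contra! h
  refine hP (MvPolynomial.funext fun x => ?_)
  have hx : x ∈ MvPolynomial.zeroLocus ℂ (MvPolynomial.vanishingIdeal ℂ S) := hS ▸ mem_univ x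
  rw [map_zero]
  exact hx P h

lemma MvPolynomial.homogeneousComponent_totalDegree_ne_zero {σ R : Type*} [CommSemiring R]
    {a : MvPolynomial σ R} (ha : a ≠ 0) : homogeneousComponent a.totalDegree a ≠ 0 := by
  obtain ⟨m, hm, hmd⟩ := Finset.exists_mem_eq_sup a.support (support_nonempty.2 ha)
    (fun s => s.sum fun _ e => e)
  intro h
  have hc := congrArg (coeff m) h
  rw [coeff_homogeneousComponent, coeff_zero, if_pos] at hc
  · exact mem_support_iff.1 hm hc
  · exact hmd.symm

/-! ### Choice of the lattice point and conclusion -/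

theorem mainTheorem6 (n : ℕ) (U : Set (Fin n → ℂ)) (hU : IsConeAtInfinity U)
    (f : Fin n → (Fin n → ℂ) → ℂ) (hf : ∀ i, IsAlgebraicFunctionOn U (f i))
    (hf0 : ∀ i, ∀ x ∈ U, ∃ y ∈ connectedComponentIn U x, f i y ≠ 0)
    (hdense : IsZariskiDense (U ∩ twoPiINonzeroIntLattice n)) :
    ∃ a ∈ U, ∀ i, Complex.exp (a i) = f i a := by
  choose P hP0 hP using fun i => (hf i).exists_poly_coeff_zero_ne hU.isOpen (hf0 i)
  have hPne : ∀ i, P i ≠ 0 := fun i h => hP0 i (by rw [h, Polynomial.coeff_zero])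
  set top : MvPolynomial (Fin n) ℂ → MvPolynomial (Fin n) ℂ := fun a =>
    MvPolynomial.homogeneousComponent a.totalDegree a with htop
  obtain ⟨x₀, ⟨hx₀U, hx₀⟩, hne⟩ := hdense.exists_eval_ne_zero
    (P := ∏ i, top (P i).leadingCoeff * top ((P i).coeff 0))
    (Finset.prod_ne_zero_iff.2 fun i _ => mul_ne_zero
      (MvPolynomial.homogeneousComponent_totalDegree_ne_zero
        (Polynomial.leadingCoeff_ne_zero.2 (hPne i)))
      (MvPolynomial.homogeneousComponent_totalDegree_ne_zero (hP0 i)))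
  rw [map_prod, Finset.prod_ne_zero_iff] at hne
  simp only [map_mul, mul_ne_zero_iff] at hne
  choose N hN using fun i =>
    eventually_norm_root_le (hne i (Finset.mem_univ i)).1 (hne i (Finset.mem_univ i)).2
  -- The `+ 1` keeps `M = K log m` positive even when `n = 0`.
  set K : ℕ := ∑ i, N i + 1 with hK
  obtain ⟨A, hA, B, hB, hAB⟩ := eventually_prod_iff.1 (eventually_all.2 hN)
  obtain ⟨ε, hε, hεB⟩ := Metric.eventually_nhds_iff_ball.1 (hB.and (hU.isOpen.mem_nhds hx₀U))
  have hlarge : ∀ᶠ t : ℝ in atTop, 32 * (K * Real.log t + 5) ^ 2 ≤ ε * t := by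
    have hlo := (Real.isLittleO_pow_log_id_atTop (n := 2)).bound
      (show 0 < ε / (32 * (K + 5) ^ 2) by positivity)
    filter_upwards [hlo, Real.tendsto_log_atTop.eventually_ge_atTop 1, eventually_ge_atTop 0]
      with t h1 h2 h3
    rw [id, Real.norm_of_nonneg (by positivity), Real.norm_of_nonneg h3, div_mul_eq_mul_div,
      le_div_iff₀ (by positivity)] at h1
    calc 32 * (K * Real.log t + 5) ^ 2 ≤ 32 * ((K + 5) * Real.log t) ^ 2 := by
          gcongr
          linarith
      _ ≤ ε * t := by linarith
  -- `m` must be an integer for `m • x₀` to stay in `(2πi ℤ)ⁿ`.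
  obtain ⟨m, hmA, hmlarge, hm1⟩ := (tendsto_natCast_atTop_atTop.eventually
    (hA.and (hlarge.and (eventually_gt_atTop (1 : ℝ))))).exists
  have hm0 : (0 : ℝ) < m := by linarith
  set p : Fin n → ℂ := (m : ℝ) • x₀ with hp
  set M : ℝ := K * Real.log m with hM
  have hMpos : 0 < M := mul_pos (by rw [hK]; positivity) (Real.log_pos hm1)
  have hexpM : Real.exp M = (m : ℝ) ^ K := by
    rw [hM, Real.exp_nat_mul, Real.exp_log hm0]
  have hball : ∀ z ∈ ball p (ε * m), z ∈ U ∧ ∀ i, f i z ≠ 0 ∧ ‖f i z‖ ≤ Real.exp M ∧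
      ‖(f i z)⁻¹‖ ≤ Real.exp M := by
    intro z hz
    -- Dividing by `m` moves `z` into the ball about `x₀`, where the cone property and the growth
    -- bound apply.
    have hzy : (m : ℝ) • ((m : ℝ)⁻¹ • z) = z := smul_inv_smul₀ hm0.ne' z
    have hy : (m : ℝ)⁻¹ • z ∈ ball x₀ ε := by
      rw [mem_ball, dist_eq_norm] at hz ⊢
      have : (m : ℝ)⁻¹ • z - x₀ = (m : ℝ)⁻¹ • (z - p) := by
        rw [smul_sub, hp, inv_smul_smul₀ hm0.ne']
      rw [this, norm_smul, norm_inv, Real.norm_of_nonneg hm0.le, inv_mul_lt_iff₀ hm0]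
      linarith
    obtain ⟨hyB, hyU⟩ := hεB _ hy
    have hzU : z ∈ U := hzy ▸ hU.smul_mem _ hyU m hm1.le
    refine ⟨hzU, fun i => ?_⟩
    have h := hAB hmA hyB i (f i z)
    simp only [hzy] at h
    have hle : (m : ℝ) ^ N i ≤ Real.exp M := by
      rw [hexpM]
      refine pow_le_pow_right₀ hm1.le ((Finset.single_le_sum (f := N) (fun _ _ => Nat.zero_le _)
        (Finset.mem_univ i)).trans (Nat.le_succ _))
    obtain ⟨h1, h2, h3⟩ := h (hP i z hzU)
    exact ⟨h1, h2.trans hle, h3.trans hle⟩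
  obtain ⟨a, ha, hfa⟩ := exists_exp_sub_eq (F := f) (p := p) (R := ε * m) hMpos hmlarge
    (fun i z hz => ((hf i).analytic z (hball z hz).1).differentiableAt.differentiableWithinAt)
    (fun i z hz => by
      obtain ⟨h1, -, h3⟩ := (hball z hz).2 i
      rw [norm_inv] at h3
      rw [Real.exp_neg]
      exact inv_le_of_inv_le₀ (norm_pos_iff.2 h1) h3)
    (fun i z hz => ((hball z hz).2 i).2.1)
  refine ⟨a, (hball a ha).1, fun i => ?_⟩
  rw [← hfa i]
  obtain ⟨k, -, hk⟩ := hx₀ i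
  have hpi : p i = ((m * k : ℤ) : ℂ) * (2 * Real.pi * Complex.I) := by
    rw [hp, Pi.smul_apply, hk, Complex.real_smul]
    push_cast
    ring
  rw [Complex.exp_sub, hpi, Complex.exp_int_mul_two_pi_mul_I, div_one]
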